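/- Let $\mathcal F\,|\,\mathbb F_q$ be an algebraic function field in one variable over the finite field $\mathbb F_q$, let $s\ge 1$, and let $\mathcal H_1,\dots,\mathcal H_s$ be non-trivial subgroups of $\mathrm{Aut}(\mathcal F|\mathbb F_q)$, with fixed fields $\mathcal F^{\mathcal H_i}$, such that (i) the product set $\mathcal G=\mathcal H_1\mathcal H_2\cdots\mathcal H_s$ is a subgroup of $\mathrm{Aut}(\mathcal F|\mathbb F_q)$; (ii') for every $i$ there is an integer $m_i\ge 1$ with $1\le \#\bigl(\mathcal H_i\cap\bigcup_{j\ne i}\mathcal H_j\bigr)\le m_i$ and $\#\mathcal H_i=r_i+m_i$ (for instance, one $m$ for all $i$). Let $T$ be a set of rational places of $\mathcal F^{\mathcal G}$ which split completely in $\mathcal F\,|\,\mathcal F^{\mathcal G}$ (that is, have exactly $[\mathcal F:\mathcal F^{\mathcal G}]$ places of $\mathcal F$ above them), and let $\mathcal P=\{P_1,\dots,P_n\}$, with the $P_k$ pairwise distinct, be the set of all places of $\mathcal F$ lying over places in $T$. Let $P_\infty$ be a rational place of $\mathcal F$ which is totally ramified in $\mathcal F\,|\,\mathcal F^{\mathcal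 G}$, and let $Q_\infty^{(i)}$ be the place of $\mathcal F^{\mathcal H_i}$ under $P_\infty$. Suppose that for $i=1,\dots,s$ there are functions $z_i,w_i$ such that (iii) $z_i\in\mathcal F^{\mathcal H_i}$ and $\mathrm{supp}((z_i)_\infty)=\{Q_\infty^{(i)}\}$; (iv) $w_i\in\mathcal F\setminus\mathcal F^{\mathcal H_i}$ and $\mathrm{supp}((w_i)_\infty)=\{P_\infty\}$; (v) for every $P\in\mathcal P$ the map $Q\mapsto w_i(Q)\in\mathbb F_q$ is injective on the orbit $P^{\mathcal H_i}=\{\sigma(P):\sigma\in\mathcal H_i\}$. Let $1\le d\le n$, and let $t_i\ge 1$ be integers such that for every $i$ $$V_i:=\Bigl\{\sum_{\ell=0}^{r_i-1}\Bigl(\sum_{j=0}^{t_i}a_{\ell j}z_i^{\,j}\Bigr)w_i^{\,\ell}\ :\ a_{\ell j}\in\mathbb F_q\Bigr\}\subseteq\mathcal L\bigl((n-d)P_\infty\bigr),$$ where $\mathcal L(D)$ is the Riemann–Roch space of the divisor $D$. Put $V=\bigcap_{i=1}^s V_i$ and suppose that $\dim_{\mathbb F_q}V>0$. Then there exists an $[n,\dim_{\mathbb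 F_q}V,\ge d;\,r_1,\dots,r_s]$-recoverable code over $\mathbb F_q$, namely the evaluation code $\mathcal C=\{(f(P_1),\dots,f(P_n)):f\in V\}$. Here this means that $\mathcal C$ is a linear code of length $n$, dimension $\dim_{\mathbb F_q}V$ and minimum distance at least $d$, and that every coordinate $i$ has $(r_1,\dots,r_s)$-locality: if $g_1,\dots,g_n$ are the columns of a generator matrix of $\mathcal C$, there are pairwise disjoint sets $R_1,\dots,R_s\subseteq\{1,\dots,n\}\setminus\{i\}$ with $\#R_j=r_j$ and $g_i\in\langle g_\ell:\ell\in R_j\rangle$ for all $j$. -/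

import Mathlib

open scoped Pointwise WithZero

noncomputable section

/-- A place of the function field `F | K`, given by its valuation ring: a discrete valuation ring
of `F` (with quotient field `F`) that contains the constants `K`. -/
@[ext]
structure Place (K F : Type*) [Field K] [Field F] [Algebra K F] where
  /-- the valuation ring of the place -/
  ring : ValuationSubring F
  algebraMap_mem : ∀ c : K, algebraMap K F c ∈ ring
  isDVR : IsDiscreteValuationRing ring

namespace Place

variable {K F : Type*} [Field K] [Field F] [Algebra K F]

/-- The normalised discrete valuation of a place, written multiplicatively:
`P.val f = exp (-v_P(f))` for `f ≠ 0` and `P.val 0 = 0`. So `1 < P.val f` means that `P` is a pole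
of `f`, and `P.val f < 1` means that `P` is a zero of `f`. -/
def val (P : Place K F) : Valuation F ℤᵐ⁰ :=
  letI := P.isDVR
  (IsDiscreteValuationRing.maximalIdeal P.ring).valuation F

theorem val_algebraMap_le_one (P : Place K F) (c : K) : P.val (algebraMap K F c) ≤ 1 := by
  let _ := P.isDVR
  exact (IsDiscreteValuationRing.maximalIdeal P.ring).valuation_le_one
    (⟨algebraMap K F c, P.algebraMap_mem c⟩ : P.ring)

/-- `P` is rational (of degree one): its residue field is `K`. -/
def IsRational (P : Place K F) : Prop :=
  ∀ f : F, P.val f ≤ 1 → ∃ c : K, P.val (f - algebraMap K F c) < 1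

open Classical in
/-- The value `f(P) ∈ K` of a function `f` at a rational place `P` which is not a pole of `f`:
the constant congruent to `f` modulo `P` (and `0` if there is no such constant). -/
def eval (P : Place K F) (f : F) : K :=
  if h : ∃ c : K, P.val (f - algebraMap K F c) < 1 then h.choose else 0

/-- `supp (f)_∞`, the support of the pole divisor of `f`. -/
def poleSupport (f : F) : Set (Place K F) := {P | 1 < P.val f}

/-- The Riemann-Roch space `L(D) = {f | v_P(f) ≥ -D(P) for all places P}` of a divisor `D`. -/
def riemannRochSpace (D : Place K F →₀ ℤ) : Submodule K F where
  carrier := {f | ∀ P : Place K F, P.val f ≤ WithZero.exp (D P)}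
  zero_mem' := fun P => by simp
  add_mem' := fun {f g} hf hg P => (P.val.map_add f g).trans (max_le (hf P) (hg P))
  smul_mem' := fun c f hf P => by
    rw [Algebra.smul_def, map_mul]
    exact mul_le_of_le_one_of_le (P.val_algebraMap_le_one c) (hf P)

/-- The orbit `{σ(P) | σ ∈ H}` of a place under a group of automorphisms. -/
def orbit (H : Subgroup (F ≃ₐ[K] F)) (P : Place K F) : Set (Place K F) :=
  {Q | ∃ σ ∈ H, Q.ring = σ • P.ring}

section Extension

variable {L : Type*} [Field L] [Algebra K L] [Algebra L F]

/-- The place `P` of `F` lies over the place `Q` of the subfield `L`. -/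
def LiesOver (P : Place K F) (Q : Place K L) : Prop :=
  P.ring.comap (algebraMap L F) = Q.ring

variable (F) in
/-- `Q` splits completely in `F | L`: there are exactly `[F : L]` places of `F` over `Q`
(used for finite extensions only, where `[F : L] ≠ 0`). -/
def SplitsCompletely (Q : Place K L) : Prop :=
  {P : Place K F | P.LiesOver Q}.ncard = Module.finrank L F

variable (L) in
/-- `P` is totally ramified in `F | L`: its ramification index over the place `Q` of `L` below it
is `[F : L]`, that is, `v_P(x) = [F : L] v_Q(x)` for all `x ∈ L`. -/
def IsTotallyRamified (P : Place K F) : Prop :=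
  ∃ Q : Place K L, P.LiesOver Q ∧ ∀ x : L, P.val (algebraMap L F x) = Q.val x ^ Module.finrank L F

end Extension

end Place

/-- The space of all `∑_{l=0}^{r-1} (∑_{j=0}^{t} a_{l j} z^j) w^l` with coefficients in `K`. -/
def functionSpace (K : Type*) {F : Type*} [Field K] [Field F] [Algebra K F]
    (r t : ℕ) (z w : F) : Submodule K F where
  carrier := {f | ∃ a : ℕ → ℕ → K,
    f = ∑ l ∈ Finset.range r, (∑ j ∈ Finset.range (t + 1), algebraMap K F (a l j) * z ^ j) * w ^ l}
  zero_mem' := ⟨0, by simp⟩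
  add_mem' := by
    rintro _ _ ⟨a, rfl⟩ ⟨b, rfl⟩
    exact ⟨a + b, by simp [add_mul, Finset.sum_add_distrib]⟩
  smul_mem' := by
    rintro c _ ⟨a, rfl⟩
    exact ⟨c • a, by simp [Algebra.smul_def, Finset.mul_sum, Finset.sum_mul, mul_assoc]⟩

section Codes

variable {K : Type*} [Field K] {k n s : ℕ}

/-- The rows of `M` form a basis of the linear code `C`. -/
def IsGeneratorMatrix (M : Matrix (Fin k) (Fin n) K) (C : Submodule K (Fin n → K)) : Prop :=
  LinearIndependent K M.row ∧ Submodule.span K (Set.range M.row) = C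

/-- The coordinate `i` has `(r_1, …, r_s)`-locality with respect to the generator matrix `M` with
columns `g_1, …, g_n`: there are pairwise disjoint repair sets `R_1, …, R_s` which do not contain
`i`, with `#R_j = r_j` and `g_i ∈ ⟨g_l | l ∈ R_j⟩`. -/
def HasLocality (M : Matrix (Fin k) (Fin n) K) (r : Fin s → ℕ) (i : Fin n) : Prop :=
  ∃ R : Fin s → Finset (Fin n), Pairwise (fun j j' => Disjoint (R j) (R j')) ∧
    ∀ j, i ∉ R j ∧ (R j).card = r j ∧ M.col i ∈ Submodule.span K (M.col '' (R j : Set (Fin n)))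

open Classical in
/-- `C` is an `[n, k, ≥ d; r_1, …, r_s]`-recoverable code: a linear code of length `n`,
dimension `k` and minimum distance at least `d`, all of whose coordinates have
`(r_1, …, r_s)`-locality. -/
structure IsRecoverableCode (n k d : ℕ) (r : Fin s → ℕ) (C : Submodule K (Fin n → K)) : Prop where
  finrank_eq : Module.finrank K C = k
  le_dist : ∀ x ∈ C, ∀ y ∈ C, x ≠ y → d ≤ hammingDist x y
  locality : ∀ M : Matrix (Fin k) (Fin n) K, IsGeneratorMatrix M C → ∀ i, HasLocality M r i

end Codes

end

/-! The code is the image of the evaluation map on `V`; two facts carry its parameters. Zeros: a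
nonzero `f` in `L((n-d)P_∞)` vanishes at no more than `n-d` of the `P_k` (`Place.card_zeros_le`).
Hence evaluation is injective and the distance is at least `d`. The bound avoids divisor degrees: it
compares `dim L(mP_∞) ≤ m+1` with a large independent family built from powers of `f` and
approximate idempotents at its zeros. This needs that transcendental functions have poles. Locality:
complete splitting makes the action of `G` on the `P_k` free (`SplitsCompletely.eq_one_of_smul_eq`),
so the elements of `H_j` outside the other subgroups carry `P_k` to at least `r_j` distinct points,
and these sets are disjoint for different `j`. On an `H_j`-orbit `z_j` is constant and `w_j`
injective, so each `f ∈ V_j` is there a polynomial of degree less than `r_j` in `w_j`; Lagrange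
interpolation recovers `f(P_k)` from `r_j` other values (`exists_eval_eq_sum_of_orbit`). Two links
remain: the `P_k` are rational (`LiesOver.isRational`), and they differ from `P_∞`, which the
nontrivial group `H_1` fixes. -/

noncomputable section

/-! ### Places and weak approximation -/

namespace Place

variable {K F : Type*} [Field K] [Field F] [Algebra K F]

theorem val_le_one_iff (P : Place K F) {x : F} : P.val x ≤ 1 ↔ x ∈ P.ring := by
  let _ := P.isDVR
  constructor
  · intro h
    obtain ⟨a, rfl⟩ := IsDiscreteValuationRing.exists_lift_of_le_one (A := P.ring) h
    exact a.2
  · intro h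
    exact (IsDiscreteValuationRing.maximalIdeal P.ring).valuation_le_one (⟨x, h⟩ : P.ring)

theorem one_lt_val_iff (P : Place K F) {x : F} : 1 < P.val x ↔ x ∉ P.ring := by
  rw [← P.val_le_one_iff, not_le]

theorem exists_uniformizer (P : Place K F) : ∃ π : F, P.val π = WithZero.exp (-1) := by
  let _ := P.isDVR
  exact (IsDiscreteValuationRing.maximalIdeal P.ring).valuation_exists_uniformizer F

theorem exists_one_lt_val (P : Place K F) : ∃ x : F, 1 < P.val x := by
  obtain ⟨π, hπ⟩ := P.exists_uniformizer
  refine ⟨π⁻¹, ?_⟩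
  rw [map_inv₀, hπ, ← WithZero.exp_neg, ← WithZero.exp_zero, WithZero.exp_lt_exp]
  simp

/-- A discrete valuation ring is maximal among the proper subrings of its fraction field. -/
theorem eq_of_ring_le {P Q : Place K F} (h : P.ring ≤ Q.ring) : P = Q := by
  have := P.isDVR
  refine Place.ext (ValuationSubring.eq_of_le_of_ne_top _ h fun h' => ?_)
  obtain ⟨x, hx⟩ := Q.exists_one_lt_val
  rw [one_lt_val_iff, h'] at hx
  exact hx trivial

theorem exists_mem_notMem {P Q : Place K F} (h : P ≠ Q) : ∃ x, x ∈ P.ring ∧ x ∉ Q.ring := by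
  by_contra! h'
  exact h (eq_of_ring_le h')

theorem _root_.WithZeroMulInt.eventually_pow_mul_lt_one {u : ℤᵐ⁰} (hu : u < 1) (v : ℤᵐ⁰) :
    ∀ᶠ m : ℕ in Filter.atTop, u ^ m * v < 1 := by
  rcases eq_or_ne v 0 with rfl | hv
  · simp
  obtain ⟨N, hN⟩ := exists_pow_lt₀ hu (Units.mk0 v⁻¹ (inv_ne_zero hv))
  filter_upwards [Filter.eventually_ge_atTop N] with m hm
  have h1 : u ^ m < v⁻¹ := (pow_le_pow_right_of_le_one' hu.le hm).trans_lt hN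
  calc u ^ m * v < v⁻¹ * v := mul_lt_mul_of_pos_right h1 (zero_lt_iff.mpr hv)
    _ = 1 := inv_mul_cancel₀ hv

theorem exists_one_lt_lt_one (P : Place K F) (S : Finset (Place K F)) (hP : P ∉ S) :
    ∃ x : F, 1 < P.val x ∧ ∀ Q ∈ S, Q.val x < 1 := by
  classical
  induction S using Finset.induction_on with
  | empty =>
    obtain ⟨x, hx⟩ := P.exists_one_lt_val
    exact ⟨x, hx, by simp⟩
  | insert Q S _ ih =>
    simp only [Finset.mem_insert, not_or] at hP
    obtain ⟨a, haP, haS⟩ := ih hP.2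
    obtain ⟨b, hbP, hbQ⟩ : ∃ b : F, 1 < P.val b ∧ Q.val b < 1 := by
      obtain ⟨y, hyP, hyQ⟩ := exists_mem_notMem hP.1
      obtain ⟨z, hzQ, hzP⟩ := exists_mem_notMem (Ne.symm hP.1)
      rw [← val_le_one_iff] at hyP hzQ
      rw [← one_lt_val_iff] at hyQ hzP
      have hy : y ≠ 0 := by rintro rfl; simp at hyQ
      refine ⟨z / y, ?_, ?_⟩
      · rw [map_div₀, one_lt_div₀ (zero_lt_iff.mpr (by simpa using hy))]
        exact hyP.trans_lt hzP
      · rw [map_div₀, div_lt_one₀ (zero_lt_iff.mpr (by simpa using hy))]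
        exact hzQ.trans_lt hyQ
    have hev : ∀ᶠ m : ℕ in Filter.atTop, ∀ R ∈ S, R.val a ^ m * R.val b < 1 := by
      rw [Filter.eventually_all_finset]
      exact fun R hR => WithZeroMulInt.eventually_pow_mul_lt_one (haS R hR) _
    obtain ⟨m, hm, hm1⟩ := (hev.and (Filter.eventually_ge_atTop 1)).exists
    have hm0 : m ≠ 0 := by omega
    -- If `a` has no pole at `Q`, a high power of `a` times `b` works. Otherwise `a ^ m / (1 + a ^
    -- m)` is a unit at the poles of `a`, in particular at `P` and `Q`, and still tends to `0` on
    -- `S`.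
    rcases le_or_gt (Q.val a) 1 with haQ | haQ
    · refine ⟨a ^ m * b, ?_, ?_⟩
      · rw [map_mul, map_pow]
        exact one_lt_mul'' (one_lt_pow₀ haP hm0) hbP
      · intro R hR
        rw [map_mul, map_pow]
        rcases Finset.mem_insert.mp hR with rfl | hR
        · exact mul_lt_one_of_nonneg_of_lt_one_right (pow_le_one' haQ m) zero_le hbQ
        · exact hm R hR
    · have key : ∀ R : Place K F, 1 < R.val a → R.val (a ^ m / (1 + a ^ m) * b) = R.val b := by
        intro R hR
        have h1 : 1 < R.val (a ^ m) := by rw [map_pow]; exact one_lt_pow₀ hR hm0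
        have h2 : R.val (1 + a ^ m) = R.val (a ^ m) :=
          R.val.map_add_eq_of_lt_right (by rwa [map_one])
        rw [map_mul, map_div₀, h2, div_self (zero_lt_one.trans h1).ne', one_mul]
      refine ⟨a ^ m / (1 + a ^ m) * b, by rwa [key P haP], ?_⟩
      intro R hR
      rcases Finset.mem_insert.mp hR with rfl | hR
      · rwa [key R haQ]
      · have h1 : R.val (a ^ m) < 1 := by rw [map_pow]; exact pow_lt_one' (haS R hR) hm0
        have h2 : R.val (1 + a ^ m) = 1 := by
          rw [← R.val.map_one]
          exact R.val.map_add_eq_of_lt_left (by rwa [map_one])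
        rw [map_mul, map_div₀, h2, div_one, map_pow]
        exact hm R hR

/-- An element congruent to `1` at `P` and to `0` at finitely many other places. -/
theorem exists_val_sub_one_lt (P : Place K F) (S : Finset (Place K F)) :
    ∃ x : F, P.val (x - 1) < 1 ∧ ∀ Q ∈ S, Q ≠ P → Q.val x < 1 := by
  classical
  obtain ⟨x, hxP, hxS⟩ := P.exists_one_lt_lt_one (S.erase P) (by simp)
  have h2 : P.val (1 + x) = P.val x := P.val.map_add_eq_of_lt_right (by rwa [map_one])
  have h0 : (1 + x) ≠ 0 := by
    intro h
    rw [h, map_zero] at h2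
    rw [← h2] at hxP
    exact not_lt_zero hxP
  -- The map `x ↦ x / (1 + x)` sends the pole at `P` to residue `1` and zeros to zeros.
  refine ⟨x / (1 + x), ?_, fun Q hQ hQP => ?_⟩
  · have : x / (1 + x) - 1 = -(1 + x)⁻¹ := by field_simp; ring
    rw [this, Valuation.map_neg, map_inv₀, h2]
    exact inv_lt_one_of_one_lt₀ hxP
  · have h1 := hxS Q (Finset.mem_erase.mpr ⟨hQP, hQ⟩)
    have h3 : Q.val (1 + x) = 1 := by
      rw [← Q.val.map_one]
      exact Q.val.map_add_eq_of_lt_left (by rwa [map_one])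
    rwa [map_div₀, h3, div_one]

theorem val_algebraMap_mul_lt_one (P : Place K F) (c : K) {x : F} (hx : P.val x < 1) :
    P.val (algebraMap K F c * x) < 1 := by
  rw [map_mul]
  exact mul_lt_one_of_nonneg_of_lt_one_right (P.val_algebraMap_le_one c) zero_le hx

/-- Weak approximation of constants. -/
theorem exists_val_sub_lt (S : Finset (Place K F)) (c : Place K F → K) :
    ∃ x : F, ∀ Q ∈ S, Q.val (x - algebraMap K F (c Q)) < 1 := by
  classical
  choose e he1 he0 using fun P : Place K F => P.exists_val_sub_one_lt S
  refine ⟨∑ R ∈ S, algebraMap K F (c R) * e R, fun Q hQ => ?_⟩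
  have : ∑ R ∈ S, algebraMap K F (c R) * e R - algebraMap K F (c Q) =
      algebraMap K F (c Q) * (e Q - 1) + ∑ R ∈ S.erase Q, algebraMap K F (c R) * e R := by
    rw [← Finset.add_sum_erase S _ hQ]; ring
  rw [this]
  refine Q.val.map_add_lt (Q.val_algebraMap_mul_lt_one _ (he1 Q)) ?_
  refine Q.val.map_sum_lt one_ne_zero fun R hR => Q.val_algebraMap_mul_lt_one _ ?_
  exact he0 R Q hQ (Finset.ne_of_mem_erase hR).symm

theorem val_lt_one_iff (P : Place K F) {x : F} : P.val x < 1 ↔ x = 0 ∨ x⁻¹ ∉ P.ring := by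
  rcases eq_or_ne x 0 with rfl | hx
  · simp
  · rw [← one_lt_val_iff, map_inv₀, one_lt_inv₀ (zero_lt_iff.mpr (by simpa using hx))]
    simp [hx]

/-! ### Automorphisms acting on places; fibres over a fixed field -/

instance : SMul (F ≃ₐ[K] F) (Place K F) where
  smul σ P :=
    { ring := σ • P.ring
      algebraMap_mem := fun c => by
        rw [ValuationSubring.mem_pointwise_smul_iff_inv_smul_mem, AlgEquiv.smul_def,
          AlgEquiv.commutes]
        exact P.algebraMap_mem c
      isDVR := by
        have := P.isDVR
        let e : P.ring ≃+* (σ • P.ring : ValuationSubring F) :=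
          P.ring.toSubring.equivMapOfInjective (MulSemiringAction.toRingHom _ F σ) σ.injective
        exact IsDiscreteValuationRing.RingEquivClass.isDiscreteValuationRing e }

theorem smul_ring (σ : F ≃ₐ[K] F) (P : Place K F) : (σ • P).ring = σ • P.ring := rfl

instance : MulAction (F ≃ₐ[K] F) (Place K F) :=
  Function.Injective.mulAction Place.ring (fun _ _ h => Place.ext h) smul_ring

theorem mem_smul_ring_iff (σ : F ≃ₐ[K] F) (P : Place K F) {x : F} :
    x ∈ (σ • P).ring ↔ σ⁻¹ x ∈ P.ring :=
  ValuationSubring.mem_pointwise_smul_iff_inv_smul_mem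

theorem smul_val_le_one_iff (σ : F ≃ₐ[K] F) (P : Place K F) {x : F} :
    (σ • P).val x ≤ 1 ↔ P.val (σ⁻¹ x) ≤ 1 := by
  simp only [val_le_one_iff, mem_smul_ring_iff]

theorem smul_val_lt_one_iff (σ : F ≃ₐ[K] F) (P : Place K F) {x : F} :
    (σ • P).val x < 1 ↔ P.val (σ⁻¹ x) < 1 := by
  simp only [val_lt_one_iff, mem_smul_ring_iff, map_inv₀, map_eq_zero_iff _ (σ⁻¹).injective]

theorem mem_orbit_iff {H : Subgroup (F ≃ₐ[K] F)} {P Q : Place K F} :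
    Q ∈ Place.orbit H P ↔ ∃ σ ∈ H, Q = σ • P := by
  simp only [Place.orbit, Set.mem_ofPred_eq, Place.ext_iff, smul_ring]

section LiesOver

variable {L : Type*} [Field L] [Algebra K L] [Algebra L F]

theorem LiesOver.val_le_one_iff {P : Place K F} {Q : Place K L} (h : P.LiesOver Q) {x : L} :
    P.val (algebraMap L F x) ≤ 1 ↔ Q.val x ≤ 1 := by
  rw [P.val_le_one_iff, Q.val_le_one_iff, ← h, ValuationSubring.mem_comap]

theorem LiesOver.val_lt_one_iff {P : Place K F} {Q : Place K L} (h : P.LiesOver Q) {x : L} :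
    P.val (algebraMap L F x) < 1 ↔ Q.val x < 1 := by
  rw [P.val_lt_one_iff, Q.val_lt_one_iff, ← h, ValuationSubring.mem_comap, map_inv₀,
    map_eq_zero_iff _ (algebraMap L F).injective]

end LiesOver

variable {G : Subgroup (F ≃ₐ[K] F)}

theorem LiesOver.smul {P : Place K F} {Q : Place K (IntermediateField.fixedField G)}
    (h : P.LiesOver Q) {σ : F ≃ₐ[K] F} (hσ : σ ∈ G) : (σ • P).LiesOver Q := by
  rw [LiesOver] at h ⊢
  rw [← h]
  ext x
  rw [ValuationSubring.mem_comap, ValuationSubring.mem_comap, mem_smul_ring_iff]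
  exact iff_of_eq (congrArg (· ∈ P.ring)
    ((IntermediateField.mem_fixedField_iff G _).mp x.2 _ (inv_mem hσ)))

/-- If the orbits of `P` and `P'` were disjoint, some `x` would be `1` along the first and `0` along
the second. Its norm lies in the fixed field, is a unit at `P` and vanishes at `P'`, which is
impossible for two places over the same `Q`. -/
theorem LiesOver.exists_smul_eq [Finite G] {P P' : Place K F}
    {Q : Place K (IntermediateField.fixedField G)} (h : P.LiesOver Q) (h' : P'.LiesOver Q) :
    ∃ σ ∈ G, P' = σ • P := by
  classical
  have := Fintype.ofFinite G
  by_contra! hne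
  let S₁ : Finset (Place K F) := Finset.univ.image fun σ : G => (σ : F ≃ₐ[K] F)⁻¹ • P
  let S₀ : Finset (Place K F) := Finset.univ.image fun σ : G => (σ : F ≃ₐ[K] F)⁻¹ • P'
  obtain ⟨x, hx⟩ := exists_val_sub_lt (S₁ ∪ S₀) (fun R => if R ∈ S₁ then (1 : K) else 0)
  have h1 : ∀ σ : G, P.val ((σ : F ≃ₐ[K] F) x) = 1 := by
    intro σ
    have hm : (σ : F ≃ₐ[K] F)⁻¹ • P ∈ S₁ := Finset.mem_image_of_mem _ (Finset.mem_univ σ)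
    have := hx _ (Finset.mem_union_left _ hm)
    rw [if_pos hm, map_one, smul_val_lt_one_iff, inv_inv, map_sub, map_one] at this
    have h2 := P.val.map_add_eq_of_lt_right (x := (σ : F ≃ₐ[K] F) x - 1) (y := 1)
      (by rwa [map_one])
    rwa [sub_add_cancel, map_one] at h2
  have h0 : ∀ σ : G, P'.val ((σ : F ≃ₐ[K] F) x) < 1 := by
    intro σ
    have hm : (σ : F ≃ₐ[K] F)⁻¹ • P' ∈ S₀ := Finset.mem_image_of_mem _ (Finset.mem_univ σ)
    have hn : (σ : F ≃ₐ[K] F)⁻¹ • P' ∉ S₁ := by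
      intro hmem
      obtain ⟨τ, -, hτ⟩ := Finset.mem_image.mp hmem
      refine hne (σ * (τ : F ≃ₐ[K] F)⁻¹) (mul_mem σ.2 (inv_mem τ.2)) ?_
      rw [mul_smul]
      rw [hτ, smul_inv_smul]
    have := hx _ (Finset.mem_union_right _ hm)
    rwa [if_neg hn, map_zero, sub_zero, smul_val_lt_one_iff, inv_inv] at this
  let N : IntermediateField.fixedField G := ⟨∏ σ : G, (σ : F ≃ₐ[K] F) x, by
    rw [IntermediateField.mem_fixedField_iff]
    intro τ hτ
    rw [map_prod]
    exact Fintype.prod_equiv (Equiv.mulLeft (⟨τ, hτ⟩ : G)) _ _ fun σ => rfl⟩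
  have hP : ¬ P.val (algebraMap _ F N) < 1 := by
    change ¬ P.val (∏ σ : G, (σ : F ≃ₐ[K] F) x) < 1
    rw [map_prod, Finset.prod_congr rfl fun σ _ => h1 σ]
    simp
  have hP' : P'.val (algebraMap _ F N) < 1 := by
    change P'.val (∏ σ : G, (σ : F ≃ₐ[K] F) x) < 1
    rw [map_prod, ← Finset.mul_prod_erase _ _ (Finset.mem_univ 1)]
    refine mul_lt_one_of_nonneg_of_lt_one_left zero_le (h0 1) ?_
    exact Finset.prod_le_one' fun σ _ => (h0 σ).le
  rw [h.val_lt_one_iff] at hP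
  rw [h'.val_lt_one_iff] at hP'
  exact hP hP'

theorem finrank_fixedField [Finite G] :
    Module.finrank (IntermediateField.fixedField G) F = Nat.card G := by
  have := Fintype.ofFinite G
  rw [Nat.card_eq_fintype_card]
  exact FixedPoints.finrank_eq_card G F

/-- The orbit map from `G` onto the fibre is surjective between finite sets of equal size, hence
injective. -/
theorem SplitsCompletely.eq_one_of_smul_eq [Finite G] {P : Place K F}
    {Q : Place K (IntermediateField.fixedField G)} (hQ : Q.SplitsCompletely F)
    (h : P.LiesOver Q) {σ : F ≃ₐ[K] F} (hσ : σ ∈ G) (hfix : σ • P = P) : σ = 1 := by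
  rw [SplitsCompletely, finrank_fixedField] at hQ
  let f : G → {P : Place K F | P.LiesOver Q} := fun τ => ⟨(τ : F ≃ₐ[K] F) • P, h.smul τ.2⟩
  have hf : Function.Surjective f := by
    rintro ⟨P', hP'⟩
    obtain ⟨τ, hτ, rfl⟩ := h.exists_smul_eq hP'
    exact ⟨⟨τ, hτ⟩, rfl⟩
  have hbij : Function.Bijective f :=
    (Nat.bijective_iff_surjective_and_card f).mpr ⟨hf, by rw [← hQ]; rfl⟩
  have : (⟨σ, hσ⟩ : G) = 1 := hbij.1 (Subtype.ext (by simpa [f] using hfix))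
  exact congrArg Subtype.val this

/-- Every residue at `P` already comes from `Q`: a suitable `e ^ m * f` agrees with `f` at `P` and
vanishes at all other conjugates of `P`, so its trace is an element of the fixed field congruent to
`f` at `P`. -/
theorem LiesOver.isRational [Finite G] {P : Place K F}
    {Q : Place K (IntermediateField.fixedField G)} (hrat : Q.IsRational) (h : P.LiesOver Q)
    (hfree : ∀ σ ∈ G, σ • P = P → σ = 1) : P.IsRational := by
  classical
  have := Fintype.ofFinite G
  intro f hf
  let S : Finset (Place K F) := Finset.univ.image fun σ : G => (σ : F ≃ₐ[K] F)⁻¹ • P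
  obtain ⟨e, he1, he0⟩ := P.exists_val_sub_one_lt S
  have heP : P.val e = 1 := by
    have h2 := P.val.map_add_eq_of_lt_right (x := e - 1) (y := 1) (by rwa [map_one])
    rwa [sub_add_cancel, map_one] at h2
  -- The power of `e` has to absorb possible poles of `f` at the other conjugates.
  have hev : ∀ᶠ m : ℕ in Filter.atTop, ∀ R ∈ S, R ≠ P → R.val e ^ m * R.val f < 1 := by
    rw [Filter.eventually_all_finset]
    intro R hR
    by_cases hRP : R = P
    · simp [hRP]
    · filter_upwards [WithZeroMulInt.eventually_pow_mul_lt_one (he0 R hR hRP) (R.val f)]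
        with m hm _ using hm
  obtain ⟨m, hm⟩ := hev.exists
  have hem : P.val (e ^ m - 1) < 1 := by
    rw [← mul_geom_sum, map_mul]
    refine mul_lt_one_of_nonneg_of_lt_one_left zero_le he1 ?_
    exact P.val.map_sum_le fun i _ => by rw [map_pow, heP, one_pow]
  have h1 : P.val (e ^ m * f - f) < 1 := by
    rw [← sub_one_mul, map_mul]
    exact mul_lt_one_of_nonneg_of_lt_one_left zero_le hem hf
  have h0 : ∀ σ : G, σ ≠ 1 → P.val ((σ : F ≃ₐ[K] F) (e ^ m * f)) < 1 := by
    intro σ hσ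
    have := hm _ (Finset.mem_image_of_mem _ (Finset.mem_univ σ)) (fun hfix => hσ (by
      have := hfree _ (inv_mem σ.2) hfix
      rw [inv_eq_one] at this
      exact Subtype.ext this))
    rwa [← map_pow, ← map_mul, smul_val_lt_one_iff, inv_inv] at this
  let t : IntermediateField.fixedField G := ⟨∑ σ : G, (σ : F ≃ₐ[K] F) (e ^ m * f), by
    rw [IntermediateField.mem_fixedField_iff]
    intro τ hτ
    rw [map_sum]
    exact Fintype.sum_equiv (Equiv.mulLeft (⟨τ, hτ⟩ : G)) _ _ fun σ => rfl⟩
  have ht : P.val (algebraMap _ F t - f) < 1 := by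
    change P.val ((∑ σ : G, (σ : F ≃ₐ[K] F) (e ^ m * f)) - f) < 1
    rw [← Finset.add_sum_erase _ _ (Finset.mem_univ 1), add_sub_right_comm]
    refine P.val.map_add_lt h1 (P.val.map_sum_lt one_ne_zero fun σ hσ => ?_)
    exact h0 σ (Finset.ne_of_mem_erase hσ)
  have ht1 : P.val (algebraMap _ F t) ≤ 1 := by
    have := P.val.map_add_le ht.le hf
    rwa [sub_add_cancel] at this
  obtain ⟨c, hc⟩ := hrat t (h.val_le_one_iff.mp ht1)
  rw [← h.val_lt_one_iff, map_sub, ← IsScalarTower.algebraMap_apply K _ F] at hc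
  refine ⟨c, ?_⟩
  have := P.val.map_sub_lt hc ht
  rwa [sub_sub_sub_cancel_left] at this

end Place
end

/-! ### Existence of poles -/

noncomputable section

open Polynomial IntermediateField

/-- The exponent `k` embeds the value group into `ℤ`; an element with least positive `k` is a
uniformizer. -/
theorem ValuationSubring.isDiscreteValuationRing_of_pow_eq {F : Type*} [Field F]
    (B : ValuationSubring F) {y : F} (hy0 : y ≠ 0) (hy : B.valuation y < 1) {M : ℕ} (hM : M ≠ 0)
    (h : ∀ x : F, x ≠ 0 → ∃ k : ℤ, B.valuation x ^ M = B.valuation y ^ k) :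
    IsDiscreteValuationRing B := by
  classical
  have hvy : 0 < B.valuation y := zero_lt_iff.mpr (by simpa using hy0)
  have hanti : StrictAnti fun k : ℤ => B.valuation y ^ k := zpow_right_strictAnti₀ hvy hy
  choose! k hk using h
  have hkeq : ∀ {x : F}, x ≠ 0 → ∀ {j : ℤ}, B.valuation x ^ M = B.valuation y ^ j → k x = j :=
    fun hx j hj => hanti.injective ((hk _ hx).symm.trans hj)
  have hkmul : ∀ {a b : F}, a ≠ 0 → b ≠ 0 → k (a * b) = k a + k b := fun {a b} ha hb =>
    hkeq (mul_ne_zero ha hb) (by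
      rw [map_mul, mul_pow, hk a ha, hk b hb, zpow_add₀ hvy.ne'])
  have hkpow : ∀ {a : F}, a ≠ 0 → ∀ n : ℕ, k (a ^ n) = n * k a := fun {a} ha n =>
    hkeq (pow_ne_zero n ha) (by
      rw [map_pow, ← pow_mul, mul_comm n M, pow_mul, hk a ha, ← zpow_natCast, ← zpow_mul,
        mul_comm])
  have hmem : ∀ {x : F}, x ≠ 0 → (x ∈ B ↔ 0 ≤ k x) := fun {x} hx => by
    rw [← B.valuation_le_one_iff, ← pow_le_one_iff hM, hk x hx, ← zpow_zero (B.valuation y)]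
    exact hanti.le_iff_ge
  have hunit : ∀ {x : F}, x ≠ 0 → k x = 0 → B.valuation x = 1 := fun {x} hx hkx => by
    have h1 : B.valuation x ^ M = 1 := by rw [hk x hx, hkx, zpow_zero]
    exact le_antisymm ((pow_le_one_iff hM).mp h1.le) ((one_le_pow_iff hM).mp h1.ge)
  have hky : k y = M := hkeq hy0 (zpow_natCast _ _).symm
  have hex : ∃ m : ℕ, 0 < m ∧ ∃ x : F, x ≠ 0 ∧ k x = m := ⟨M, Nat.pos_of_ne_zero hM, y, hy0, hky⟩
  obtain ⟨hm, π, hπ0, hkπ⟩ := Nat.find_spec hex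
  have hmin : ∀ {x : F}, x ≠ 0 → 0 ≤ k x → k x < k π → k x = 0 := by
    intro x hx h0 hlt
    by_contra hne
    refine Nat.find_min hex (m := (k x).toNat) (by omega) ⟨by omega, x, hx, by omega⟩
  have hkπ0 : 0 < k π := by omega
  have hπB : π ∈ B := (hmem hπ0).mpr hkπ0.le
  have hk1 : ∀ u : Bˣ, k (u : B) = 0 := fun u =>
    hkeq (by simp) (by rw [ValuationSubring.valuation_unit, one_pow, zpow_zero])
  refine IsDiscreteValuationRing.ofHasUnitMulPowIrreducibleFactorization
    ⟨⟨π, hπB⟩, ⟨fun hu => ?_, fun {a b} hab => ?_⟩, fun {x} hx => ?_⟩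
  · have := hk1 hu.unit
    simp only [IsUnit.unit_spec] at this
    omega
  · have hab' : π = a * b := congrArg Subtype.val hab
    have ha0 : (a : F) ≠ 0 := by rintro h0; exact hπ0 (by rw [hab', h0, zero_mul])
    have hb0 : (b : F) ≠ 0 := by rintro h0; exact hπ0 (by rw [hab', h0, mul_zero])
    have hsum : k π = k a + k b := by rw [← hkmul ha0 hb0, ← hab']
    have ha := (hmem ha0).mp a.2
    have hb := (hmem hb0).mp b.2
    rw [B.valuation_eq_one_iff, B.valuation_eq_one_iff]
    by_cases h : k a < k π
    · exact Or.inl (hunit ha0 (hmin ha0 ha h))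
    · exact Or.inr (hunit hb0 (by omega))
  · have hx0 : (x : F) ≠ 0 := by simpa using hx
    have hkx := (hmem hx0).mp x.2
    obtain ⟨n, hn⟩ : ∃ n : ℕ, (n : ℤ) = k x / k π :=
      ⟨(k x / k π).toNat, Int.toNat_of_nonneg (Int.ediv_nonneg hkx hkπ0.le)⟩
    have hu0 : (x : F) / π ^ n ≠ 0 := div_ne_zero hx0 (pow_ne_zero n hπ0)
    have hku : k ((x : F) / π ^ n) = k x % k π := by
      have := hkmul hu0 (pow_ne_zero n hπ0)
      rw [div_mul_cancel₀ _ (pow_ne_zero n hπ0), hkpow hπ0, hn] at this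
      have h2 := Int.emod_add_mul_ediv (k x) (k π)
      linarith [mul_comm (k π) (k x / k π)]
    have hku0 : k ((x : F) / π ^ n) = 0 :=
      hmin hu0 (by rw [hku]; exact Int.emod_nonneg _ hkπ0.ne')
        (by rw [hku]; exact Int.emod_lt_of_pos _ hkπ0)
    have huB : (x : F) / π ^ n ∈ B := (hmem hu0).mpr hku0.ge
    have hu : IsUnit (⟨_, huB⟩ : B) := (B.valuation_eq_one_iff _).mpr (hunit hu0 hku0)
    refine ⟨n, hu.unit, Subtype.ext ?_⟩
    simp only [IsUnit.unit_spec]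
    change π ^ n * ((x : F) / π ^ n) = x
    field_simp

/-- A term of strictly largest value would determine the value of the sum. -/
theorem Valuation.exists_ne_eq_of_sum_eq_zero {R Γ ι : Type*} [Ring R]
    [LinearOrderedCommGroupWithZero Γ] (v : Valuation R Γ) {s : Finset ι} {f : ι → R}
    (hs : s.Nonempty) (hf : ∀ i ∈ s, v (f i) ≠ 0) (h : ∑ i ∈ s, f i = 0) :
    ∃ i ∈ s, ∃ j ∈ s, i ≠ j ∧ v (f i) = v (f j) := by
  classical
  obtain ⟨i, hi, hmax⟩ := s.exists_max_image (fun i => v (f i)) hs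
  by_contra! hne
  refine hf i hi ?_
  rw [← v.map_sum_eq_of_lt hi fun j hj => ?_, h, map_zero]
  rw [Finset.mem_sdiff, Finset.mem_singleton] at hj
  exact lt_of_le_of_ne (hmax j hj.1) (hne j hj.1 i hi hj.2)

section Pole

variable {K F : Type*} [Field K] [Field F] [Algebra K F]

theorem ValuationSubring.valuation_algebraMap_eq_one (B : ValuationSubring F)
    (hK : ∀ c : K, algebraMap K F c ∈ B) {c : K} (hc : c ≠ 0) :
    B.valuation (algebraMap K F c) = 1 := by
  refine le_antisymm ((B.valuation_le_one_iff _).mpr (hK c)) ?_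
  rw [← inv_le_one₀ (zero_lt_iff.mpr (by simpa using hc)), ← map_inv₀, ← map_inv₀]
  exact (B.valuation_le_one_iff _).mpr (hK _)

/-- After splitting off the power of `X` in `p`, the cofactor has a nonzero constant term, so its
value at `y` is a unit of `B`. -/
theorem ValuationSubring.exists_valuation_aeval_eq (B : ValuationSubring F)
    (hK : ∀ c : K, algebraMap K F c ∈ B) {y : F} (hy : B.valuation y < 1) {p : K[X]} (hp : p ≠ 0) :
    ∃ k : ℕ, B.valuation (aeval y p) = B.valuation y ^ k := by
  obtain ⟨q, hq, hX⟩ := exists_eq_pow_rootMultiplicity_mul_and_not_dvd p hp 0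
  rw [C_0, sub_zero] at hq hX
  refine ⟨p.rootMultiplicity 0, ?_⟩
  have hq0 : q.coeff 0 ≠ 0 := fun h => hX (X_dvd_iff.mpr h)
  have hmem : ∀ r : K[X], aeval y r ∈ B := fun r => by
    rw [aeval_eq_sum_range]
    refine sum_mem fun i _ => ?_
    rw [Algebra.smul_def]
    exact B.mul_mem _ _ (hK _) (pow_mem ((B.valuation_le_one_iff _).mp hy.le) i)
  have h1 : B.valuation (aeval y q) = 1 := by
    conv_lhs => rw [← divX_mul_X_add q]
    rw [map_add, map_mul, aeval_X, aeval_C, ← B.valuation_algebraMap_eq_one hK hq0]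
    refine B.valuation.map_add_eq_of_lt_right ?_
    rw [B.valuation_algebraMap_eq_one hK hq0, map_mul]
    exact mul_lt_one_of_nonneg_of_lt_one_right ((B.valuation_le_one_iff _).mpr (hmem _))
      zero_le hy
  conv_lhs => rw [hq]
  rw [map_mul, map_mul, h1, mul_one, map_pow, aeval_X, map_pow]

/-- Two terms of the minimal equation of `x` over `K(y)` have equal value, which puts some `v(x) ^
(j - i)` into the group generated by `v(y)`. The factorial is an exponent that serves all `x` at
once, since `j - i` is at most the degree. -/
theorem ValuationSubring.exists_pow_factorial_eq (B : ValuationSubring F)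
    (hK : ∀ c : K, algebraMap K F c ∈ B) {y : F} (hy0 : y ≠ 0) (hy : B.valuation y < 1)
    [FiniteDimensional K⟮y⟯ F] {x : F} (hx : x ≠ 0) :
    ∃ k : ℤ, B.valuation x ^ (Module.finrank K⟮y⟯ F).factorial = B.valuation y ^ k := by
  have hvy : B.valuation y ≠ 0 := by simpa using hy0
  have hvx : B.valuation x ≠ 0 := by simpa using hx
  have hbase : ∀ a : K⟮y⟯, a ≠ 0 → ∃ k : ℤ, B.valuation (a : F) = B.valuation y ^ k := by
    rintro ⟨a, ha⟩ ha0
    obtain ⟨p, q, rfl⟩ := mem_adjoin_simple_iff K a |>.mp ha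
    have hpq : aeval y p / aeval y q ≠ 0 := fun h => ha0 (Subtype.ext h)
    have hp : p ≠ 0 := by rintro rfl; simp at hpq
    have hq : q ≠ 0 := by rintro rfl; simp at hpq
    obtain ⟨k, hk⟩ := B.exists_valuation_aeval_eq hK hy hp
    obtain ⟨l, hl⟩ := B.exists_valuation_aeval_eq hK hy hq
    exact ⟨k - l, by rw [map_div₀, hk, hl, zpow_sub₀ hvy, zpow_natCast, zpow_natCast]⟩
  have key : ∀ i j : ℕ, i < j → j ≤ Module.finrank K⟮y⟯ F → ∀ a b : K⟮y⟯, a ≠ 0 → b ≠ 0 →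
      B.valuation ((a : F) * x ^ i) = B.valuation ((b : F) * x ^ j) →
      ∃ k : ℤ, B.valuation x ^ (Module.finrank K⟮y⟯ F).factorial = B.valuation y ^ k := by
    intro i j hij hj a b ha hb h
    obtain ⟨k, hk⟩ := hbase a ha
    obtain ⟨l, hl⟩ := hbase b hb
    obtain ⟨c, hc⟩ : (j - i) ∣ (Module.finrank K⟮y⟯ F).factorial :=
      Nat.dvd_factorial (by omega) (by omega)
    have h1 : B.valuation x ^ (j - i) = B.valuation y ^ (k - l) := by
      rw [map_mul, map_mul, hk, hl, map_pow, map_pow] at h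
      rw [zpow_sub₀ hvy, eq_div_iff (zpow_ne_zero _ hvy)]
      refine mul_left_cancel₀ (pow_ne_zero i hvx) ?_
      rw [← mul_assoc, ← pow_add, Nat.add_sub_cancel' hij.le, mul_comm, ← h, mul_comm]
    exact ⟨(k - l) * c, by rw [hc, pow_mul, h1, zpow_mul, zpow_natCast]⟩
  have hint : IsIntegral K⟮y⟯ x := IsIntegral.of_finite _ _
  have hsum : ∑ i ∈ (minpoly K⟮y⟯ x).support, ((minpoly K⟮y⟯ x).coeff i : F) * x ^ i = 0 := by
    have := minpoly.aeval K⟮y⟯ x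
    rw [aeval_def, eval₂_eq_sum, Polynomial.sum] at this
    exact this
  obtain ⟨i, hi, j, hj, hij, hv⟩ := B.valuation.exists_ne_eq_of_sum_eq_zero
    (support_nonempty.mpr (minpoly.ne_zero hint))
    (fun i hi => by
      rw [mem_support_iff] at hi
      simpa [hx] using hi) hsum
  rw [mem_support_iff] at hi hj
  have hle : ∀ {i}, (minpoly K⟮y⟯ x).coeff i ≠ 0 → i ≤ Module.finrank K⟮y⟯ F := fun h =>
    (le_natDegree_of_ne_zero h).trans (minpoly.natDegree_le x)
  rcases hij.lt_or_gt with h | h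
  · exact key i j h (hle hj) _ _ hi hj hv
  · exact key j i h (hle hi) _ _ hj hi hv.symm

/-- Every transcendental element of a function field has a pole. -/
theorem Place.exists_one_lt_val_of_transcendental [Algebra (RatFunc K) F]
    [IsScalarTower K (RatFunc K) F] [FunctionField K F] {f : F} (hf : Transcendental K f) :
    ∃ P : Place K F, 1 < P.val f := by
  have hf0 : f ≠ 0 := by rintro rfl; exact hf isAlgebraic_zero
  have hy0 : f⁻¹ ≠ 0 := inv_ne_zero hf0
  have hy : Transcendental K f⁻¹ := fun h => hf (by simpa using h.inv)
  have hfin : FiniteDimensional K⟮f⁻¹⟯ F :=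
    FunctionField.finiteDimensional_of_adjoin_transcendental hy
  let A : Subring F := (Algebra.adjoin K {f⁻¹}).toSubring
  let yA : A := ⟨f⁻¹, Algebra.self_mem_adjoin_singleton K f⁻¹⟩
  -- As `f⁻¹` is transcendental, it is not a unit in `K[f⁻¹]`; a valuation ring in which it is a
  -- nonunit then gives a pole of `f`.
  have hI : Ideal.span {yA} ≠ ⊤ := by
    intro h
    rw [Ideal.span_singleton_eq_top, isUnit_iff_exists_inv] at h
    obtain ⟨⟨b, hb⟩, hab⟩ := h
    have hb' : b ∈ Algebra.adjoin K {f⁻¹} := hb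
    rw [Algebra.adjoin_singleton_eq_range_aeval] at hb'
    obtain ⟨p, rfl⟩ := hb'
    have h1 : f⁻¹ * aeval f⁻¹ p = 1 := congrArg Subtype.val hab
    have h2 : aeval f⁻¹ (X * p - 1) = 0 := by simp [h1]
    have h3 : X * p - 1 = 0 := by
      by_contra hne
      exact hy ⟨_, hne, h2⟩
    have h4 := congrArg (coeff · 0) h3
    simp at h4
  obtain ⟨B, hAB, hIB⟩ := Ideal.image_subset_nonunits_valuationSubring _ hI
  have hK : ∀ c : K, algebraMap K F c ∈ B := fun c =>
    hAB ((Algebra.adjoin K {f⁻¹}).algebraMap_mem c)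
  have hyB : B.valuation f⁻¹ < 1 := B.mem_nonunits_iff.mp
    (hIB ⟨yA, Ideal.mem_span_singleton_self yA, rfl⟩)
  refine ⟨⟨B, hK, B.isDiscreteValuationRing_of_pow_eq hy0 hyB (Nat.factorial_ne_zero _)
    fun x hx => B.exists_pow_factorial_eq hK hy0 hyB hx⟩, ?_⟩
  rw [Place.one_lt_val_iff]
  rw [← B.mem_nonunits_iff, B.inv_mem_nonunits_iff] at hyB
  exact hyB.resolve_left hf0

end Pole
end

/-! ### Counting zeros -/

noncomputable section

open Polynomial IntermediateField

namespace Place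

variable {K F : Type*} [Field K] [Field F] [Algebra K F]

theorem mem_ring_of_isIntegral {R : Type*} [CommRing R] [Algebra R F] (P : Place K F)
    (hR : ∀ a : R, algebraMap R F a ∈ P.ring) {x : F} (hx : IsIntegral R x) : x ∈ P.ring := by
  have h : IsIntegral P.ring x :=
    hx.map_of_comp_eq ((algebraMap R F).codRestrict P.ring hR) (RingHom.id F) rfl
  obtain ⟨y, rfl⟩ := IsIntegrallyClosed.isIntegral_iff.mp h
  exact y.2

theorem eq_zero_of_isAlgebraic (P : Place K F) {x : F} (hx : IsAlgebraic K x)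
    (h : P.val x < 1) : x = 0 :=
  (P.val_lt_one_iff.mp h).resolve_right fun h' =>
    h' (P.mem_ring_of_isIntegral P.algebraMap_mem hx.inv.isIntegral)

theorem mem_riemannRochSpace_single {P : Place K F} {m : ℤ} {f : F} :
    f ∈ riemannRochSpace (Finsupp.single P m) ↔
      P.val f ≤ WithZero.exp m ∧ ∀ Q : Place K F, Q ≠ P → Q.val f ≤ 1 := by
  classical
  constructor
  · intro h
    refine ⟨by simpa using h P, fun Q hQ => ?_⟩
    have := h Q
    rwa [Finsupp.single_eq_of_ne hQ, WithZero.exp_zero] at this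
  · rintro ⟨h1, h2⟩ Q
    by_cases hQ : Q = P
    · subst hQ; simpa using h1
    · rw [Finsupp.single_eq_of_ne hQ, WithZero.exp_zero]; exact h2 Q hQ

/-- Raising the allowed pole order by one adds at most one generator, because the leading
coefficient at a rational place lies in `K`. For order `0`, a function without poles is algebraic,
hence equal to its residue at `P`. -/
theorem exists_riemannRochSpace_single_le_span [Algebra (RatFunc K) F]
    [IsScalarTower K (RatFunc K) F] [FunctionField K F] {P : Place K F} (hP : P.IsRational) (m : ℕ) :
    ∃ S : Finset F, S.card ≤ m + 1 ∧
      riemannRochSpace (Finsupp.single P (m : ℤ)) ≤ Submodule.span K (S : Set F) := by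
  classical
  induction m with
  | zero =>
    refine ⟨{1}, by simp, fun f hf => ?_⟩
    rw [mem_riemannRochSpace_single, Nat.cast_zero, WithZero.exp_zero] at hf
    obtain ⟨c, hc⟩ := hP f hf.1
    have halg : IsAlgebraic K f := by
      by_contra h
      obtain ⟨Q, hQ⟩ := exists_one_lt_val_of_transcendental h
      by_cases hQP : Q = P
      · subst hQP; exact hQ.not_ge hf.1
      · exact hQ.not_ge (hf.2 Q hQP)
    have := P.eq_zero_of_isAlgebraic (halg.sub (isAlgebraic_algebraMap c)) hc
    rw [Finset.coe_singleton, Submodule.mem_span_singleton]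
    exact ⟨c, by rw [Algebra.smul_def, mul_one]; exact (sub_eq_zero.mp this).symm⟩
  | succ m ih =>
    obtain ⟨S, hS, hle⟩ := ih
    by_cases hex : riemannRochSpace (Finsupp.single P ((m + 1 : ℕ) : ℤ)) ≤
        riemannRochSpace (Finsupp.single P (m : ℤ))
    · exact ⟨S, by omega, hex.trans hle⟩
    obtain ⟨g, hg, hgm⟩ := SetLike.not_le_iff_exists.mp hex
    rw [mem_riemannRochSpace_single] at hg
    have hlt : ∀ {x : ℤᵐ⁰}, x < WithZero.exp ((m + 1 : ℕ) : ℤ) ↔ x ≤ WithZero.exp (m : ℤ) := by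
      intro x
      rw [Nat.cast_succ, WithZero.exp_add, WithZero.lt_mul_exp_iff_le WithZero.exp_ne_zero]
    have hgv : P.val g = WithZero.exp ((m + 1 : ℕ) : ℤ) := by
      refine le_antisymm hg.1 (not_lt.mp fun h => hgm ?_)
      rw [mem_riemannRochSpace_single]
      exact ⟨hlt.mp h, hg.2⟩
    have hg0 : g ≠ 0 := by rintro rfl; simp at hgv
    refine ⟨insert g S, (Finset.card_insert_le _ _).trans (by omega), fun f hf => ?_⟩
    rw [mem_riemannRochSpace_single] at hf
    obtain ⟨c, hc⟩ := hP (f / g) (by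
      rw [map_div₀, hgv]; exact div_le_one_of_le₀ hf.1 zero_le)
    have hsub : f - algebraMap K F c * g ∈ riemannRochSpace (Finsupp.single P (m : ℤ)) := by
      rw [mem_riemannRochSpace_single]
      constructor
      · rw [← hlt, ← hgv]
        have : f - algebraMap K F c * g = (f / g - algebraMap K F c) * g := by field_simp
        rw [this, map_mul]
        exact mul_lt_of_lt_one_left (by rw [hgv]; exact WithZero.exp_pos) hc
      · intro Q hQ
        refine Q.val.map_sub_le (hf.2 Q hQ) ?_
        rw [map_mul]
        exact mul_le_one' (Q.val_algebraMap_le_one c) (hg.2 Q hQ)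
    rw [← sub_add_cancel f (algebraMap K F c * g)]
    refine add_mem ?_ ?_
    · exact Submodule.span_mono (by simp) (hle hsub)
    · rw [← Algebra.smul_def]
      exact Submodule.smul_mem _ _ (Submodule.subset_span (by simp))

theorem card_le_of_linearIndependent [Algebra (RatFunc K) F] [IsScalarTower K (RatFunc K) F]
    [FunctionField K F] {P : Place K F} (hP : P.IsRational) (m : ℕ) {ι : Type*} [Fintype ι]
    {b : ι → F} (hb : LinearIndependent K b)
    (hmem : ∀ i, b i ∈ riemannRochSpace (Finsupp.single P (m : ℤ))) : Fintype.card ι ≤ m + 1 := by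
  obtain ⟨S, hS, hle⟩ := exists_riemannRochSpace_single_le_span hP m
  rw [← finrank_span_eq_card hb]
  refine (Submodule.finrank_mono ?_).trans ((finrank_span_finset_le_card S).trans hS)
  rw [Submodule.span_le]
  rintro _ ⟨i, rfl⟩
  exact hle (hmem i)

theorem val_aeval_le_one (P : Place K F) {f : F} (hf : P.val f ≤ 1) (p : K[X]) :
    P.val (aeval f p) ≤ 1 := by
  rw [aeval_eq_sum_range]
  refine P.val.map_sum_le fun i _ => ?_
  rw [Algebra.smul_def, map_mul, map_pow]
  exact mul_le_one' (P.val_algebraMap_le_one _) (pow_le_one' hf i)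

theorem val_algebraMap_lt_one_iff (P : Place K F) {c : K} :
    P.val (algebraMap K F c) < 1 ↔ c = 0 := by
  constructor
  · intro h
    simpa using P.eq_zero_of_isAlgebraic (isAlgebraic_algebraMap c) h
  · rintro rfl
    simp

/-- Elements that are `1` at one zero of `f` and `0` at the other ones are independent
over `K[f]`. -/
theorem eq_zero_of_sum_aeval_mul_eq_zero {f : F} (hf0 : f ≠ 0) {S : Finset (Place K F)}
    (hS : ∀ P ∈ S, P.val f < 1) {e : Place K F → F} (he1 : ∀ P : Place K F, P.val (e P - 1) < 1)
    (he0 : ∀ P : Place K F, ∀ Q ∈ S, Q ≠ P → Q.val (e P) < 1) (g : Place K F → K[X])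
    (h : ∑ P ∈ S, aeval f (g P) * e P = 0) : ∀ P ∈ S, g P = 0 := by
  classical
  suffices ∀ (n : ℕ) (g : Place K F → K[X]), ∑ P ∈ S, aeval f (g P) * e P = 0 →
      ∀ P ∈ S, (g P).coeff n = 0 from fun P hP => Polynomial.ext fun n => by
    simpa using this n g h P hP
  have h0 : ∀ g : Place K F → K[X], ∑ P ∈ S, aeval f (g P) * e P = 0 →
      ∀ P ∈ S, (g P).coeff 0 = 0 := by
    intro g hg Q hQ
    rw [← Q.val_algebraMap_lt_one_iff]
    -- Reduction of the relation modulo `Q`: `f` vanishes there, `e Q` is `1`, and the other `e P`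
    -- vanish.
    have hsum : algebraMap K F ((g Q).coeff 0) =
        -(aeval f (divX (g Q)) * f + (aeval f (g Q) * (e Q - 1) +
          ∑ P ∈ S.erase Q, aeval f (g P) * e P)) := by
      rw [← Finset.add_sum_erase S _ hQ] at hg
      have := congrArg (aeval f) (divX_mul_X_add (g Q))
      rw [map_add, map_mul, aeval_X, aeval_C] at this
      linear_combination this + hg
    have hfQ := val_aeval_le_one Q (hS Q hQ).le
    rw [hsum, Valuation.map_neg]
    refine Q.val.map_add_lt ?_ (Q.val.map_add_lt ?_ (Q.val.map_sum_lt one_ne_zero fun P hP => ?_))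
    · rw [map_mul]
      exact mul_lt_one_of_nonneg_of_lt_one_right (hfQ _) zero_le (hS Q hQ)
    · rw [map_mul]
      exact mul_lt_one_of_nonneg_of_lt_one_right (hfQ _) zero_le (he1 Q)
    · rw [map_mul]
      exact mul_lt_one_of_nonneg_of_lt_one_right (hfQ _) zero_le
        (he0 P Q hQ (Finset.ne_of_mem_erase hP).symm)
  intro n
  induction n with
  | zero => exact h0
  | succ n ih =>
    intro g hg P hP
    rw [← coeff_divX]
    -- All constant terms vanish, so the relation can be divided by `f`.
    refine ih (fun P => divX (g P)) (mul_left_cancel₀ hf0 ?_) P hP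
    rw [mul_zero, ← hg, Finset.mul_sum]
    refine Finset.sum_congr rfl fun Q hQ => ?_
    conv_rhs => rw [← divX_mul_X_add (g Q), h0 g hg Q hQ]
    simp only [C_0, add_zero, map_mul, aeval_X]
    ring

/-- Each zero `P` contributes the independent functions `q_P(f) e_P f^j`, whose only possible pole
is `Pinf`. With `j ≤ c + 1` and `c` bounding the pole orders of the `q_P(f) e_P`, this gives `#S (c
+ 2) ≤ (c + 1)(a + 1)`, which forces `#S ≤ a`. -/
theorem card_zeros_le_of_transcendental [Algebra (RatFunc K) F] [IsScalarTower K (RatFunc K) F]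
    [FunctionField K F] {Pinf : Place K F} (hPinf : Pinf.IsRational) {a : ℕ} {f : F}
    (hf : f ∈ riemannRochSpace (Finsupp.single Pinf (a : ℤ))) (htr : Transcendental K f)
    {S : Finset (Place K F)} (hS : ∀ P ∈ S, P.val f < 1) : S.card ≤ a := by
  classical
  have hf0 : f ≠ 0 := by rintro rfl; exact htr isAlgebraic_zero
  have hfin : FiniteDimensional K⟮f⟯ F :=
    FunctionField.finiteDimensional_of_adjoin_transcendental htr
  choose e he1 he0 using fun P : Place K F => P.exists_val_sub_one_lt S
  -- Clearing denominators makes `e P` integral over `K[f]`, hence regular wherever `f` is, that is,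
  -- away from `Pinf`.
  have hint : ∀ P : Place K F, ∃ q : K[X], q ≠ 0 ∧
      IsIntegral (Algebra.adjoin K {f}) (aeval f q * e P) := by
    intro P
    have halg : IsAlgebraic (Algebra.adjoin K {f}) (e P) :=
      isAlgebraic_adjoin_iff.mp (Algebra.IsAlgebraic.isAlgebraic _)
    obtain ⟨⟨y, hy⟩, hy0, hyint⟩ := halg.exists_integral_multiple
    have hy' := hy
    rw [Algebra.adjoin_singleton_eq_range_aeval] at hy'
    obtain ⟨q, rfl⟩ := hy'
    refine ⟨q, ?_, hyint⟩
    rintro rfl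
    exact hy0 (Subtype.ext (map_zero _))
  choose q hq0 hqint using hint
  rw [mem_riemannRochSpace_single] at hf
  have hu : ∀ P Q : Place K F, Q ≠ Pinf → Q.val (aeval f (q P) * e P) ≤ 1 := by
    intro P Q hQ
    rw [val_le_one_iff]
    refine Q.mem_ring_of_isIntegral ?_ (hqint P)
    rintro ⟨y, hy⟩
    rw [Algebra.adjoin_singleton_eq_range_aeval] at hy
    obtain ⟨p, rfl⟩ := hy
    exact Q.val_le_one_iff.mp (Q.val_aeval_le_one (hf.2 Q hQ) p)
  obtain ⟨c, hc⟩ : ∃ c : ℕ, ∀ P ∈ S, Pinf.val (aeval f (q P) * e P) ≤ WithZero.exp (c : ℤ) := by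
    have : ∀ x : ℤᵐ⁰, ∃ c : ℕ, x ≤ WithZero.exp (c : ℤ) := by
      intro x
      rcases eq_or_ne x 0 with rfl | hx
      · exact ⟨0, zero_le⟩
      · exact ⟨(WithZero.log x).toNat, by
          rw [← WithZero.log_le_iff_le_exp hx]; exact Int.self_le_toNat _⟩
    choose k hk using this
    refine ⟨S.sup fun P => k (Pinf.val (aeval f (q P) * e P)), fun P hP => (hk _).trans ?_⟩
    rw [WithZero.exp_le_exp, Nat.cast_le]
    exact Finset.le_sup (f := fun P => k (Pinf.val (aeval f (q P) * e P))) hP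
  let b : S × Fin (c + 2) → F := fun i => aeval f (q i.1) * e i.1 * f ^ (i.2 : ℕ)
  have hb : LinearIndependent K b := by
    rw [Fintype.linearIndependent_iff]
    intro g hg
    let p : Place K F → K[X] := fun P =>
      if hP : P ∈ S then ∑ j : Fin (c + 2), monomial (j : ℕ) (g (⟨P, hP⟩, j)) else 0
    have hsum : ∑ P ∈ S, aeval f (p P * q P) * e P = 0 := by
      rw [← hg, Fintype.sum_prod_type, ← Finset.sum_coe_sort S]
      refine Finset.sum_congr rfl fun P _ => ?_
      simp only [p, b, P.2, dif_pos, map_mul, map_sum, aeval_monomial, Finset.sum_mul]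
      refine Finset.sum_congr rfl fun j _ => ?_
      rw [Algebra.smul_def]
      ring
    have hz := eq_zero_of_sum_aeval_mul_eq_zero hf0 hS he1 he0 _ hsum
    rintro ⟨⟨P, hP⟩, j⟩
    have hpP : p P = 0 := (mul_eq_zero.mp (hz P hP)).resolve_right (hq0 P)
    have := congrArg (coeff · (j : ℕ)) hpP
    simpa [p, hP, finsetSum_coeff, coeff_monomial, Fin.val_inj] using this
  have hcard := card_le_of_linearIndependent hPinf (c + (c + 1) * a) hb (by
    rintro ⟨⟨P, hP⟩, j⟩
    rw [mem_riemannRochSpace_single]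
    constructor
    · simp only [b]
      rw [map_mul, map_pow, Nat.cast_add, WithZero.exp_add]
      refine mul_le_mul' (hc P hP) ?_
      calc Pinf.val f ^ (j : ℕ) ≤ WithZero.exp (a : ℤ) ^ (j : ℕ) := pow_le_pow_left' hf.1 _
        _ ≤ WithZero.exp (((c + 1) * a : ℕ) : ℤ) := by
          rw [← WithZero.exp_nsmul, WithZero.exp_le_exp, nsmul_eq_mul]
          exact_mod_cast Nat.mul_le_mul_right a (by omega)
    · intro Q hQ
      simp only [b]
      rw [map_mul, map_pow]
      exact mul_le_one' (hu P Q hQ) (pow_le_one' (hf.2 Q hQ) _))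
  rw [Fintype.card_prod, Fintype.card_coe, Fintype.card_fin] at hcard
  by_contra! hlt
  have : (a + 1) * (c + 2) ≤ S.card * (c + 2) := Nat.mul_le_mul_right _ hlt
  nlinarith

/-- A nonzero function whose only pole is a rational place has at most as many zeros as
the order of this pole. -/
theorem card_zeros_le [Algebra (RatFunc K) F] [IsScalarTower K (RatFunc K) F]
    [FunctionField K F] {Pinf : Place K F} (hPinf : Pinf.IsRational) {a : ℕ} {f : F}
    (hf : f ∈ riemannRochSpace (Finsupp.single Pinf (a : ℤ))) (hf0 : f ≠ 0)
    {S : Finset (Place K F)} (hS : ∀ P ∈ S, P.val f < 1) : S.card ≤ a := by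
  by_cases halg : IsAlgebraic K f
  · have : S = ∅ := Finset.eq_empty_of_forall_notMem fun P hP =>
      hf0 (P.eq_zero_of_isAlgebraic halg (hS P hP))
    simp [this]
  · exact card_zeros_le_of_transcendental hPinf hf halg hS

end Place
end

/-! ### Evaluation, interpolation and products of subgroups -/

noncomputable section

open Polynomial

namespace Place

variable {K F : Type*} [Field K] [Field F] [Algebra K F]

theorem eval_eq_of_val_sub_lt (P : Place K F) {f : F} {c : K}
    (h : P.val (f - algebraMap K F c) < 1) : P.eval f = c := by
  have hex : ∃ c : K, P.val (f - algebraMap K F c) < 1 := ⟨c, h⟩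
  rw [eval, dif_pos hex]
  have := P.val.map_sub_lt h hex.choose_spec
  rwa [sub_sub_sub_cancel_left, ← map_sub, val_algebraMap_lt_one_iff, sub_eq_zero] at this

theorem IsRational.val_sub_eval_lt {P : Place K F} (hP : P.IsRational) {f : F}
    (hf : P.val f ≤ 1) : P.val (f - algebraMap K F (P.eval f)) < 1 := by
  obtain ⟨c, hc⟩ := hP f hf
  rwa [P.eval_eq_of_val_sub_lt hc]

/-- Evaluation at a rational place, as a ring homomorphism on its valuation ring. -/
def IsRational.evalHom {P : Place K F} (hP : P.IsRational) : P.ring →+* K where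
  toFun f := P.eval (f : F)
  map_one' := P.eval_eq_of_val_sub_lt (by simp)
  map_zero' := P.eval_eq_of_val_sub_lt (by simp)
  map_add' f g := P.eval_eq_of_val_sub_lt (by
    have hf := hP.val_sub_eval_lt (P.val_le_one_iff.mpr f.2)
    have hg := hP.val_sub_eval_lt (P.val_le_one_iff.mpr g.2)
    have := P.val.map_add_lt hf hg
    rwa [← add_sub_add_comm, ← map_add] at this)
  map_mul' f g := P.eval_eq_of_val_sub_lt (by
    have hf := hP.val_sub_eval_lt (P.val_le_one_iff.mpr f.2)
    have hg := hP.val_sub_eval_lt (P.val_le_one_iff.mpr g.2)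
    have : ((f * g : P.ring) : F) - algebraMap K F (P.eval f * P.eval g) =
        f * (g - algebraMap K F (P.eval g)) +
          algebraMap K F (P.eval g) * (f - algebraMap K F (P.eval f)) := by
      rw [map_mul, MulMemClass.coe_mul]; ring
    rw [this]
    refine P.val.map_add_lt ?_ (P.val_algebraMap_mul_lt_one _ hf)
    rw [map_mul]
    exact mul_lt_one_of_nonneg_of_lt_one_right (P.val_le_one_iff.mpr f.2) zero_le hg)

theorem IsRational.evalHom_apply {P : Place K F} (hP : P.IsRational) (f : P.ring) :
    hP.evalHom f = P.eval (f : F) := rfl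

theorem eval_algebraMap (P : Place K F) (c : K) : P.eval (algebraMap K F c) = c :=
  P.eval_eq_of_val_sub_lt (by simp)

theorem IsRational.eval_add {P : Place K F} (hP : P.IsRational) {f g : F} (hf : f ∈ P.ring)
    (hg : g ∈ P.ring) : P.eval (f + g) = P.eval f + P.eval g :=
  hP.evalHom.map_add ⟨f, hf⟩ ⟨g, hg⟩

theorem IsRational.eval_smul {P : Place K F} (hP : P.IsRational) (c : K) {f : F}
    (hf : f ∈ P.ring) : P.eval (c • f) = c * P.eval f := by
  have := map_mul hP.evalHom ⟨_, P.algebraMap_mem c⟩ ⟨f, hf⟩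
  rw [hP.evalHom_apply, hP.evalHom_apply, hP.evalHom_apply, eval_algebraMap] at this
  rw [← this, Algebra.smul_def]
  rfl

theorem IsRational.eval_sum_mul_pow {P : Place K F} (hP : P.IsRational) {z w : F}
    (hz : z ∈ P.ring) (hw : w ∈ P.ring) (r t : ℕ) (a : ℕ → ℕ → K) :
    P.eval (∑ l ∈ Finset.range r,
      (∑ j ∈ Finset.range (t + 1), algebraMap K F (a l j) * z ^ j) * w ^ l) =
    ∑ l ∈ Finset.range r, (∑ j ∈ Finset.range (t + 1), a l j * P.eval z ^ j) * P.eval w ^ l := by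
  let c : ℕ → ℕ → P.ring := fun l j => ⟨algebraMap K F (a l j), P.algebraMap_mem _⟩
  let z' : P.ring := ⟨z, hz⟩
  let w' : P.ring := ⟨w, hw⟩
  have hc : ∀ l j, hP.evalHom (c l j) = a l j := fun l j => P.eval_algebraMap _
  have h : hP.evalHom (∑ l ∈ Finset.range r, (∑ j ∈ Finset.range (t + 1), c l j * z' ^ j) * w' ^ l) =
      ∑ l ∈ Finset.range r, (∑ j ∈ Finset.range (t + 1), a l j * hP.evalHom z' ^ j) *
        hP.evalHom w' ^ l := by
    simp only [map_sum, map_mul, map_pow, hc]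
  rw [hP.evalHom_apply, hP.evalHom_apply, hP.evalHom_apply] at h
  rw [← h]
  simp [c, z', w']

theorem smul_eval (σ : F ≃ₐ[K] F) {P : Place K F} (hP : P.IsRational) {f : F}
    (hf : σ⁻¹ f ∈ P.ring) : (σ • P).eval f = P.eval (σ⁻¹ f) := by
  refine (σ • P).eval_eq_of_val_sub_lt ?_
  rw [smul_val_lt_one_iff, map_sub, AlgEquiv.commutes]
  exact hP.val_sub_eval_lt (P.val_le_one_iff.mpr hf)

end Place

/-- The coefficients are the values at `x` of the Lagrange basis. They do not depend on `p`, so one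
relation serves every codeword. -/
theorem Lagrange.exists_eval_eq_sum {K ι : Type*} [Field K] (s : Finset ι) {v : ι → K}
    (hv : Set.InjOn v s) (x : K) :
    ∃ c : ι → K, ∀ p : K[X], p.degree < s.card → p.eval x = ∑ i ∈ s, c i * p.eval (v i) := by
  classical
  refine ⟨fun i => (Lagrange.basis s v i).eval x, fun p hp => ?_⟩
  conv_lhs => rw [Lagrange.eq_interpolate hv hp]
  rw [Lagrange.interpolate_apply, eval_finsetSum]
  exact Finset.sum_congr rfl fun i _ => by rw [eval_mul, eval_C, mul_comm]

theorem functionSpace_zero (K : Type*) {F : Type*} [Field K] [Field F] [Algebra K F] (t : ℕ)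
    (z w : F) : functionSpace K 0 t z w = ⊥ := by
  rw [eq_bot_iff]
  rintro _ ⟨a, rfl⟩
  simp

/-- Through this, the inclusion of `V_i` in `L((n-d)P_∞)` bounds the poles of `z_i` itself in `F`.
-/
theorem mem_functionSpace (K : Type*) {F : Type*} [Field K] [Field F] [Algebra K F] {r t : ℕ}
    (hr : r ≠ 0) (ht : 1 ≤ t) (z w : F) : z ∈ functionSpace K r t z w := by
  refine ⟨fun l j => if l = 0 ∧ j = 1 then 1 else 0, ?_⟩
  rw [Finset.sum_eq_single_of_mem 0 (by simpa using Nat.pos_of_ne_zero hr)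
      (fun l _ hl => by simp [hl]),
    Finset.sum_eq_single_of_mem 1 (by simp; omega) (fun j _ hj => by simp [hj])]
  simp

section Product

variable {A : Type*} [Group A] {s : ℕ} {H : Fin s → Subgroup A} {G : Subgroup A}

theorem Set.subset_list_prod_of_mem {l : List (Set A)} (h1 : ∀ S ∈ l, (1 : A) ∈ S) {S : Set A}
    (hS : S ∈ l) : S ⊆ l.prod := by
  have hone : ∀ l : List (Set A), (∀ S ∈ l, (1 : A) ∈ S) → (1 : A) ∈ l.prod := by
    intro l
    induction l with
    | nil => simp
    | cons T l ih =>
      intro h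
      rw [List.prod_cons]
      exact Set.mem_mul.mpr ⟨1, h T (by simp), 1, ih fun S hS => h S (by simp [hS]), mul_one 1⟩
  induction l with
  | nil => simp at hS
  | cons T l ih =>
    rw [List.prod_cons]
    have hl : ∀ S ∈ l, (1 : A) ∈ S := fun S hS => h1 S (by simp [hS])
    rcases List.mem_cons.mp hS with rfl | hS
    · exact Set.subset_mul_left _ (hone l hl)
    · exact (ih hl hS).trans (Set.subset_mul_right _ (h1 T (by simp)))

theorem Subgroup.le_of_eq_prod_ofFn
    (hG : (G : Set A) = (List.ofFn fun i => (H i : Set A)).prod) (i : Fin s) : H i ≤ G := by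
  rw [← SetLike.coe_subset_coe, hG]
  refine Set.subset_list_prod_of_mem (fun S hS => ?_) (List.mem_ofFn.mpr ⟨i, rfl⟩)
  obtain ⟨j, rfl⟩ := List.mem_ofFn.mp hS
  exact one_mem (H j)

theorem Subgroup.finite_of_eq_prod_ofFn
    (hG : (G : Set A) = (List.ofFn fun i => (H i : Set A)).prod) [∀ i, Finite (H i)] :
    Finite G := by
  have : (G : Set A) ⊆ Set.range fun f : ∀ i, (H i : Set A) =>
      (List.ofFn fun i => (f i : A)).prod := by
    intro σ hσ
    rw [hG, Set.mem_prod_list_ofFn] at hσ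
    exact hσ
  have hfin : ∀ i, Finite (H i : Set A) := fun i => inferInstanceAs (Finite (H i))
  exact ((Set.finite_range _).subset this).to_subtype

end Product
end

/-! ### Zeros of codewords and repair sets -/

noncomputable section

open Polynomial

/-- Evaluation at rational places of the functions of a space without poles there. -/
def evalLinearMap {K F : Type*} [Field K] [Field F] [Algebra K F] {n : ℕ} (P : Fin n → Place K F)
    (hrat : ∀ k, (P k).IsRational) (V : Submodule K F) (hV : ∀ f ∈ V, ∀ k, f ∈ (P k).ring) :
    V →ₗ[K] (Fin n → K) where
  toFun f k := (P k).eval (f : F)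
  map_add' f g := funext fun k => (hrat k).eval_add (hV f f.2 k) (hV g g.2 k)
  map_smul' c f := funext fun k => (hrat k).eval_smul c (hV f f.2 k)

theorem card_eval_eq_zero_le {K F : Type*} [Field K] [Field F] [Algebra K F]
    [Algebra (RatFunc K) F] [IsScalarTower K (RatFunc K) F] [FunctionField K F] {n : ℕ}
    {P : Fin n → Place K F} (hPinj : Function.Injective P) (hrat : ∀ k, (P k).IsRational)
    {Pinf : Place K F} (hPinf : Pinf.IsRational) (hne : ∀ k, P k ≠ Pinf) {a : ℕ} {f : F}
    (hf : f ∈ Place.riemannRochSpace (Finsupp.single Pinf (a : ℤ))) (hf0 : f ≠ 0)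
    {S : Finset (Fin n)} (hS : ∀ k ∈ S, (P k).eval f = 0) : S.card ≤ a := by
  rw [← Finset.card_map ⟨P, hPinj⟩]
  refine Place.card_zeros_le hPinf hf hf0 fun Q hQ => ?_
  obtain ⟨k, hk, rfl⟩ := Finset.mem_map.mp hQ
  have := (hrat k).val_sub_eval_lt ((Place.mem_riemannRochSpace_single.mp hf).2 _ (hne k))
  rwa [hS k hk, map_zero, sub_zero] at this

/-- The elements of `H j` outside of the other groups give disjoint sets of the prescribed
cardinalities. -/
theorem exists_pairwise_disjoint_of_free {A X : Type*} [Group A] [MulAction A X] {s n : ℕ}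
    {H : Fin s → Subgroup A} {r : Fin s → ℕ}
    (hr : ∀ i, ∃ m : ℕ, 1 ≤ ((H i : Set A) ∩ ⋃ j ≠ i, (H j : Set A)).ncard ∧
      ((H i : Set A) ∩ ⋃ j ≠ i, (H j : Set A)).ncard ≤ m ∧ Nat.card (H i) = r i + m)
    [∀ i, Finite (H i)] {G : Subgroup A} (hHG : ∀ i, H i ≤ G) {P : Fin n → X}
    {k : Fin n} (hfree : ∀ σ ∈ G, σ • P k = P k → σ = 1)
    (hmem : ∀ σ ∈ G, ∃ l, P l = σ • P k) :
    ∃ R : Fin s → Finset (Fin n), Pairwise (fun j j' => Disjoint (R j) (R j')) ∧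
      ∀ j, k ∉ R j ∧ (R j).card = r j ∧ ∀ l ∈ R j, ∃ σ ∈ H j, P l = σ • P k := by
  classical
  have hinj : ∀ σ ∈ G, ∀ τ ∈ G, σ • P k = τ • P k → σ = τ := fun σ hσ τ hτ h => by
    have := hfree (τ⁻¹ * σ) (mul_mem (inv_mem hτ) hσ) (by rw [mul_smul, h, inv_smul_smul])
    exact (inv_mul_eq_one.mp this).symm
  let D : Fin s → Set A := fun j => (H j : Set A) \ ⋃ j' ≠ j, (H j' : Set A)
  let E : Fin s → Set (Fin n) := fun j => {l | ∃ σ ∈ D j, P l = σ • P k}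
  have : Nonempty (Fin n) := ⟨k⟩
  choose! idx hidx using hmem
  -- At most `m` of the `r j + m` elements of `H j` are discarded, and by freeness the others move
  -- `P k` to distinct points.
  have hcard : ∀ j, r j ≤ (E j).toFinset.card := by
    intro j
    obtain ⟨m, -, hm, hrm⟩ := hr j
    have hfin : (H j : Set A).Finite := Set.toFinite (H j : Set A)
    have h1 := Set.ncard_inter_add_ncard_sdiff_eq_ncard (H j : Set A)
      (⋃ j' ≠ j, (H j' : Set A)) hfin
    have h2 : (H j : Set A).ncard = Nat.card (H j) := rfl
    have h3 : (D j).ncard ≤ (E j).ncard := by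
      refine Set.ncard_le_ncard_of_injOn idx (fun σ hσ => ⟨σ, hσ, hidx σ (hHG j hσ.1)⟩) ?_
      intro σ hσ τ hτ h
      refine hinj σ (hHG j hσ.1) τ (hHG j hτ.1) ?_
      rw [← hidx σ (hHG j hσ.1), ← hidx τ (hHG j hτ.1), h]
    rw [Set.ncard_eq_toFinset_card' (E j)] at h3
    have h4 : (D j).ncard = ((H j : Set A) \ ⋃ j' ≠ j, (H j' : Set A)).ncard := rfl
    omega
  choose R hRE hRcard using fun j => Finset.exists_subset_card_eq (hcard j)
  have hRmem : ∀ {j l}, l ∈ R j → ∃ σ ∈ D j, P l = σ • P k := fun {j l} hl =>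
    (Set.mem_toFinset (s := E j)).mp (hRE j hl)
  refine ⟨R, fun j j' hjj' => ?_, fun j => ⟨fun hk => ?_, hRcard j, fun l hl => ?_⟩⟩
  · refine Finset.disjoint_left.mpr fun l hl hl' => ?_
    obtain ⟨σ, hσ, hlσ⟩ := hRmem hl
    obtain ⟨τ, hτ, hlτ⟩ := hRmem hl'
    have : σ = τ := hinj σ (hHG j hσ.1) τ (hHG j' hτ.1) (hlσ.symm.trans hlτ)
    subst this
    exact hσ.2 (Set.mem_biUnion (Ne.symm hjj') hτ.1)
  · obtain ⟨σ, hσ, hkσ⟩ := hRmem hk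
    have : σ = 1 := hfree σ (hHG j hσ.1) hkσ.symm
    subst this
    -- The lower bound `1` makes the intersection nonempty, so a second index exists and its
    -- subgroup removes the identity from `D j`.
    obtain ⟨m, h1, -⟩ := hr j
    obtain ⟨x, -, hx⟩ := Set.nonempty_of_ncard_ne_zero (Nat.one_le_iff_ne_zero.mp h1)
    obtain ⟨j', hj', -⟩ := Set.mem_iUnion₂.mp hx
    exact hσ.2 (Set.mem_biUnion hj' (one_mem (H j')))
  · obtain ⟨σ, hσ, hlσ⟩ := hRmem hl
    exact ⟨σ, hσ.1, hlσ⟩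

/-- The values of the functions `∑ a_{lj} z^j w^l`, with `z` fixed by `H`, at a place are
determined linearly by their values at `r` other places of its orbit under `H`. -/
theorem exists_eval_eq_sum_of_orbit {K F : Type*} [Field K] [Field F] [Algebra K F] {n : ℕ}
    {P : Fin n → Place K F} (hPinj : Function.Injective P) (hrat : ∀ k, (P k).IsRational)
    {H : Subgroup (F ≃ₐ[K] F)} {z w : F} (hz : z ∈ IntermediateField.fixedField H)
    (hzP : ∀ k, z ∈ (P k).ring) (hwP : ∀ k, w ∈ (P k).ring) (t : ℕ) {k : Fin n}
    (hwinj : Set.InjOn (fun Q : Place K F => Q.eval w) (Place.orbit H (P k)))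
    {R : Finset (Fin n)} (hR : ∀ l ∈ R, ∃ σ ∈ H, P l = σ • P k) :
    ∃ c : Fin n → K, ∀ f ∈ functionSpace K R.card t z w,
      (P k).eval f = ∑ l ∈ R, c l * (P l).eval f := by
  have hinj : Set.InjOn (fun l => (P l).eval w) R := by
    intro l hl l' hl' h
    exact hPinj (hwinj (Place.mem_orbit_iff.mpr (hR l hl)) (Place.mem_orbit_iff.mpr (hR l' hl')) h)
  obtain ⟨c, hc⟩ := Lagrange.exists_eval_eq_sum R hinj ((P k).eval w)
  refine ⟨c, ?_⟩
  rintro _ ⟨a, rfl⟩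
  have hzR : ∀ l ∈ R, (P l).eval z = (P k).eval z := by
    intro l hl
    obtain ⟨σ, hσ, hl⟩ := hR l hl
    have hσz : σ⁻¹ z = z := (IntermediateField.mem_fixedField_iff H z).mp hz _ (inv_mem hσ)
    rw [hl, Place.smul_eval σ (hrat k) (by rw [hσz]; exact hzP k), hσz]
  -- With `z` frozen at its constant value on the orbit, `f` becomes this polynomial in `w`.
  let p : K[X] := ∑ l ∈ Finset.range R.card,
    C (∑ j ∈ Finset.range (t + 1), a l j * (P k).eval z ^ j) * X ^ l
  have hp : p.degree < R.card := by
    rw [← mem_degreeLT]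
    refine sum_mem fun l hl => mem_degreeLT.mpr ?_
    exact (degree_C_mul_X_pow_le _ _).trans_lt (by exact_mod_cast Finset.mem_range.mp hl)
  have hpe : ∀ x : K, p.eval x = ∑ l ∈ Finset.range R.card,
      (∑ j ∈ Finset.range (t + 1), a l j * (P k).eval z ^ j) * x ^ l := by
    intro x
    simp [p, eval_finsetSum]
  rw [(hrat k).eval_sum_mul_pow (hzP k) (hwP k), ← hpe, hc p hp]
  refine Finset.sum_congr rfl fun l hl => ?_
  rw [(hrat l).eval_sum_mul_pow (hzP l) (hwP l), hpe, hzR l hl]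

end

/-! ### The recoverable code -/

theorem mainTheorem4 {K F : Type*} [Field K] [Finite K] [Field F] [Algebra K F]
    [Algebra (RatFunc K) F] [IsScalarTower K (RatFunc K) F] [FunctionField K F]
    (s : ℕ) (hs : 1 ≤ s)
    (H : Fin s → Subgroup (F ≃ₐ[K] F)) (hH : ∀ i, H i ≠ ⊥)
    -- (i): the product `H_1 ⋯ H_s` is a group
    (G : Subgroup (F ≃ₐ[K] F))
    (hG : (G : Set (F ≃ₐ[K] F)) = (List.ofFn fun i => (H i : Set (F ≃ₐ[K] F))).prod)
    -- (ii')
    (r : Fin s → ℕ)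
    (hr : ∀ i, ∃ m : ℕ, 1 ≤ m ∧
      1 ≤ ((H i : Set (F ≃ₐ[K] F)) ∩ ⋃ j ≠ i, (H j : Set (F ≃ₐ[K] F))).ncard ∧
      ((H i : Set (F ≃ₐ[K] F)) ∩ ⋃ j ≠ i, (H j : Set (F ≃ₐ[K] F))).ncard ≤ m ∧
      Nat.card (H i) = r i + m)
    -- `P_1, …, P_n` are all the places over some completely split rational places
    (n : ℕ) (P : Fin n → Place K F) (hPinj : Function.Injective P)
    (T : Set (Place K (IntermediateField.fixedField G)))
    (hT : ∀ Q ∈ T, Q.IsRational ∧ Q.SplitsCompletely F)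
    (hP : Set.range P = {P' : Place K F | ∃ Q ∈ T, P'.LiesOver Q})
    -- `P_∞` and the places `Q_∞^(i)` below it
    (Pinf : Place K F) (hPinf : Pinf.IsRational)
    (hPram : Pinf.IsTotallyRamified (IntermediateField.fixedField G))
    (Qinf : ∀ i, Place K (IntermediateField.fixedField (H i)))
    (hQinf : ∀ i, Pinf.LiesOver (Qinf i))
    -- (iii), (iv), (v)
    (z : ∀ i, IntermediateField.fixedField (H i))
    (hz : ∀ i, Place.poleSupport (K := K) (z i) = {Qinf i})
    (w : Fin s → F) (hwH : ∀ i, w i ∉ IntermediateField.fixedField (H i))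
    (hw : ∀ i, Place.poleSupport (K := K) (w i) = {Pinf})
    (hwinj : ∀ i k, Set.InjOn (fun Q : Place K F => Q.eval (w i)) (Place.orbit (H i) (P k)))
    (t : Fin s → ℕ) (ht : ∀ i, 1 ≤ t i)
    (d : ℕ) (hd : 1 ≤ d) (hdn : d ≤ n)
    (hV : ∀ i, functionSpace K (r i) (t i) (z i : F) (w i) ≤
      Place.riemannRochSpace (Finsupp.single Pinf ((n : ℤ) - d)))
    (hdim : 0 < Module.finrank K
      (⨅ i, functionSpace K (r i) (t i) (z i : F) (w i) : Submodule K F)) :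
    -- the code obtained by evaluating the functions of `V = ⋂ V_i` at `P_1, …, P_n`
    ∃ C : Submodule K (Fin n → K),
      (C : Set (Fin n → K)) = (fun (f : F) (k : Fin n) => (P k).eval f) ''
        ((⨅ i, functionSpace K (r i) (t i) (z i : F) (w i) : Submodule K F) : Set F) ∧
      IsRecoverableCode n (Module.finrank K
        (⨅ i, functionSpace K (r i) (t i) (z i : F) (w i) : Submodule K F)) d r C := by
  classical
  -- `Nat.card` is `0` on infinite types, so `m ≥ 1` yields finiteness.
  have hHfin : ∀ i, Finite (H i) := fun i => by
    obtain ⟨m, hm, -, -, hc⟩ := hr i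
    exact Nat.finite_of_card_ne_zero (by omega)
  have hHG : ∀ i, H i ≤ G := Subgroup.le_of_eq_prod_ofFn hG
  have hGfin : Finite G := Subgroup.finite_of_eq_prod_ofFn hG
  set V : Submodule K F := ⨅ i, functionSpace K (r i) (t i) (z i : F) (w i) with hVdef
  have hVle : ∀ i, V ≤ functionSpace K (r i) (t i) (z i : F) (w i) := fun i => iInf_le _ i
  have hr0 : ∀ i, r i ≠ 0 := by
    intro i h
    have := hVle i
    rw [h, functionSpace_zero, le_bot_iff] at this
    rw [this, finrank_bot] at hdim
    exact lt_irrefl 0 hdim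
  rw [← Nat.cast_sub hdn] at hV
  have hzL := fun i => Place.mem_riemannRochSpace_single.mp
    (hV i (mem_functionSpace K (hr0 i) (ht i) (z i : F) (w i)))
  -- The function `z i` is `H i`-invariant and has a pole at `Pinf`, hence at every conjugate; but
  -- `Pinf` is its only possible pole in `F`.
  have hfix : ∀ i, ∀ σ ∈ H i, σ • Pinf = Pinf := by
    intro i σ hσ
    by_contra hne
    have hpole : 1 < (Qinf i).val (z i) := by
      have : Qinf i ∈ Place.poleSupport (K := K) (z i) := by rw [hz i]; rfl
      exact this
    have hσz : σ⁻¹ (z i : F) = z i :=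
      (IntermediateField.mem_fixedField_iff (H i) _).mp (z i).2 _ (inv_mem hσ)
    have h1 := (hzL i).2 _ hne
    rw [Place.smul_val_le_one_iff, hσz] at h1
    exact hpole.not_ge ((hQinf i).val_le_one_iff.mp h1)
  have hover : ∀ k, ∃ Q ∈ T, (P k).LiesOver Q := fun k => by
    have : P k ∈ Set.range P := ⟨k, rfl⟩
    rwa [hP] at this
  have hfree : ∀ k, ∀ σ ∈ G, σ • P k = P k → σ = 1 := by
    intro k σ hσ h
    obtain ⟨Q, hQ, hkQ⟩ := hover k
    exact (hT Q hQ).2.eq_one_of_smul_eq hkQ hσ h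
  have hrat : ∀ k, (P k).IsRational := by
    intro k
    obtain ⟨Q, hQ, hkQ⟩ := hover k
    exact hkQ.isRational (hT Q hQ).1 (hfree k)
  have hmem : ∀ k, ∀ σ ∈ G, ∃ l, P l = σ • P k := by
    intro k σ hσ
    obtain ⟨Q, hQ, hkQ⟩ := hover k
    have : σ • P k ∈ Set.range P := by rw [hP]; exact ⟨Q, hQ, hkQ.smul hσ⟩
    exact this
  -- A nontrivial element of the first subgroup fixes `Pinf`, whereas each `P k` has trivial
  -- stabiliser.
  have hne : ∀ k, P k ≠ Pinf := by
    intro k h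
    obtain ⟨⟨σ, hσ⟩, hσ1⟩ := Subgroup.ne_bot_iff_exists_ne_one.mp (hH ⟨0, hs⟩)
    exact hσ1 (Subtype.ext (hfree k σ (hHG _ hσ) (by rw [h]; exact hfix _ _ hσ)))
  have hzP : ∀ i k, (z i : F) ∈ (P k).ring := fun i k =>
    (P k).val_le_one_iff.mp ((hzL i).2 _ (hne k))
  have hwP : ∀ i k, w i ∈ (P k).ring := by
    intro i k
    by_contra h
    have : P k ∈ Place.poleSupport (K := K) (w i) := (P k).one_lt_val_iff.mpr h
    rw [hw i] at this
    exact hne k this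
  have hVL : ∀ f ∈ V, f ∈ Place.riemannRochSpace (Finsupp.single Pinf ((n - d : ℕ) : ℤ)) :=
    fun f hf => hV ⟨0, hs⟩ (hVle _ hf)
  have hVP : ∀ f ∈ V, ∀ k, f ∈ (P k).ring := fun f hf k =>
    (P k).val_le_one_iff.mp ((Place.mem_riemannRochSpace_single.mp (hVL f hf)).2 _ (hne k))
  let ev := evalLinearMap P hrat V hVP
  have hzeros : ∀ f : V, f ≠ 0 → (Finset.univ.filter fun k => ev f k = 0).card ≤ n - d := by
    intro f hf
    exact card_eval_eq_zero_le hPinj hrat hPinf hne (hVL f f.2) (by simpa using hf)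
      fun k hk => (Finset.mem_filter.mp hk).2
  -- A nonzero function in the kernel would have `n` zeros, more than `n - d` because `1 ≤ d ≤ n`.
  have hinj : Function.Injective ev := by
    rw [← LinearMap.ker_eq_bot, LinearMap.ker_eq_bot']
    intro f hf
    by_contra hf0
    have := hzeros f hf0
    rw [hf] at this
    simp at this
    omega
  refine ⟨LinearMap.range ev, ?_, ?_, ?_, ?_⟩
  · ext x
    constructor
    · rintro ⟨f, rfl⟩
      exact ⟨f, f.2, rfl⟩
    · rintro ⟨f, hf, rfl⟩
      exact ⟨⟨f, hf⟩, rfl⟩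
  · exact LinearMap.finrank_range_of_inj hinj
  · rintro _ ⟨f, rfl⟩ _ ⟨g, rfl⟩ hfg
    have h := hzeros (f - g) (sub_ne_zero.mpr fun h => hfg (by rw [h]))
    have hcompl := Finset.card_filter_add_card_filter_not (s := (Finset.univ : Finset (Fin n)))
      (fun k => ev (f - g) k = 0)
    rw [Finset.card_univ, Fintype.card_fin] at hcompl
    have hdist : hammingDist (ev f) (ev g) =
        (Finset.univ.filter fun k => ¬ ev (f - g) k = 0).card := by
      rw [hammingDist]
      congr 1
      ext k
      simp [sub_eq_zero]
    convert (show d ≤ hammingDist (ev f) (ev g) by omega)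
  · intro M hM k
    obtain ⟨R, hRdisj, hR⟩ := exists_pairwise_disjoint_of_free
      (fun i => (hr i).imp fun m hm => hm.2) hHG (hfree k) (hmem k)
    refine ⟨R, hRdisj, fun j => ⟨(hR j).1, (hR j).2.1, ?_⟩⟩
    obtain ⟨c, hc⟩ := exists_eval_eq_sum_of_orbit hPinj hrat (z j).2 (hzP j) (hwP j) (t j)
      (hwinj j k) (hR j).2.2
    rw [(hR j).2.1] at hc
    -- Each row of `M` is a codeword, so the recovery relation holds in every row with the same
    -- coefficients.
    have hcol : M.col k = ∑ l ∈ R j, c l • M.col l := by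
      ext m
      have hrow : M.row m ∈ LinearMap.range ev := by
        rw [← hM.2]
        exact Submodule.subset_span ⟨m, rfl⟩
      obtain ⟨f, hf⟩ := hrow
      have hMf : ∀ l, M m l = (P l).eval (f : F) := fun l => (congrFun hf l).symm
      rw [Finset.sum_apply]
      simp only [Matrix.col_apply, Pi.smul_apply, smul_eq_mul, hMf]
      exact hc f (hVle j f.2)
    rw [hcol]
    exact Submodule.sum_mem _ fun l hl => Submodule.smul_mem _ _
      (Submodule.subset_span ⟨l, hl, rfl⟩)
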